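/- Let $\mathbb H$ be a complex Hilbert space and let $T_1,\dots,T_n$ be compact operators on $\mathbb H$. For a compact operator $T$ on $\mathbb H$, let $s_1(T)\ge s_2(T)\ge\cdots$ denote the singular values of $T$, that is, the positive eigenvalues of $|T|=(T^*T)^{1/2}$ in decreasing order, repeated according to multiplicity, and followed by zeros if there are only finitely many of them. Then, for every $j=1,2,\dots$, $$s_j^2\Big(\sum_{k=1}^n T_k\Big)\le s_j\Big(\sum_{k=1}^n T_k^*T_k+\tfrac12\Big((n-2)\sum_{k=1}^n T_k^*T_k+\Big(\sum_{k=1}^n T_k^*\Big)\Big(\sum_{k=1}^n T_k\Big)\Big)\Big).$$ -/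

import Mathlib

/-- The sum of the eigenspaces of `|T| = (T^* T)^{1/2}` for all eigenvalues `μ ≥ t`. Eigenspaces of
distinct eigenvalues are independent, so its dimension is the number of eigenvalues of `|T|` that
are at least `t`, each counted with its multiplicity. -/
noncomputable def absEigenspaceGE {H : Type*} [NormedAddCommGroup H] [InnerProductSpace ℂ H]
    [CompleteSpace H] (T : H →L[ℂ] H) (t : ℝ) : Submodule ℂ H :=
  ⨆ μ ∈ Set.Ici t, Module.End.eigenspace (CFC.abs T).toLinearMap (μ : ℂ)

/-- The `j`-th singular value (`j = 1, 2, …`) of a compact operator `T`: the `j`-th largest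
eigenvalue of `|T|`, where eigenvalues are repeated according to multiplicity. That is the largest
`t > 0` such that `|T|` has at least `j` eigenvalues `≥ t` counted with multiplicity. If `|T|` has
fewer than `j` positive eigenvalues, the set is empty and the value is `sSup ∅ = 0`, so that the
list of positive eigenvalues is continued by zeros. -/
noncomputable def singularValue {H : Type*} [NormedAddCommGroup H] [InnerProductSpace ℂ H]
    [CompleteSpace H] (T : H →L[ℂ] H) (j : ℕ) : ℝ :=
  sSup {t : ℝ | 0 < t ∧ (j : Cardinal) ≤ Module.rank ℂ (absEigenspaceGE T t)}

section SingularValues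

open ContinuousLinearMap InnerProductSpace

variable {H : Type*} [NormedAddCommGroup H] [InnerProductSpace ℂ H]

/-! Write `S = ∑ T_k`. The operator on the right is `B = (n/2) ∑ T_k* T_k + (1/2) S* S`, and
Cauchy–Schwarz (`norm_sq_sum_apply_le`) gives `S* S ≤ n ∑ T_k* T_k`, hence `S* S ≤ B`. The rest is
Weyl monotonicity by counting dimensions: were there fewer than `j` eigenvalues of `B` at or above
`t ^ 2`, a space of dimension at least `j` on which `‖S x‖ ≥ t ‖x‖` would contain a nonzero `x`
orthogonal to their eigenvectors, where `⟨x, B x⟩ < t ^ 2 ‖x‖ ^ 2`. -/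

theorem isCompactOperator_sum {ι : Type*} (s : Finset ι) {A : ι → H →L[ℂ] H}
    (hA : ∀ k, IsCompactOperator (A k)) : IsCompactOperator (∑ k ∈ s, A k : H →L[ℂ] H) := by
  classical
  induction s using Finset.induction_on with
  | empty => exact isCompactOperator_zero
  | insert a s ha ih =>
    rw [Finset.sum_insert ha]
    exact (hA a).add ih

theorem norm_sq_sum_apply_le {ι : Type*} [Fintype ι] (T : ι → H →L[ℂ] H) (x : H) :
    ‖(∑ k, T k) x‖ ^ 2 ≤ Fintype.card ι * ∑ k, ‖T k x‖ ^ 2 := by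
  calc ‖(∑ k, T k) x‖ ^ 2 ≤ (∑ k, ‖T k x‖) ^ 2 := by
        rw [_root_.sum_apply]
        gcongr
        exact norm_sum_le _ _
    _ ≤ Fintype.card ι * ∑ k, ‖T k x‖ ^ 2 := sq_sum_le_card_mul_sum_sq

variable [CompleteSpace H]

/-- `‖|T| x‖ = ‖T x‖`. -/
theorem norm_cfcAbs_apply (T : H →L[ℂ] H) (x : H) : ‖CFC.abs T x‖ = ‖T x‖ := by
  have hsa : adjoint (CFC.abs T) = CFC.abs T :=
    (IsSelfAdjoint.of_nonneg (CFC.abs_nonneg T)).adjoint_eq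
  have h : adjoint (CFC.abs T) ∘L CFC.abs T = adjoint T ∘L T := by
    rw [hsa]
    exact CFC.abs_mul_abs T
  have h1 := apply_norm_sq_eq_inner_adjoint_left (CFC.abs T) x
  have h2 := apply_norm_sq_eq_inner_adjoint_left T x
  have h3 : ‖CFC.abs T x‖ ^ 2 = ‖T x‖ ^ 2 := by rw [h1, h2, h]
  exact (sq_eq_sq₀ (norm_nonneg _) (norm_nonneg _)).1 h3

theorem isSymmetric_cfcAbs (T : H →L[ℂ] H) : (CFC.abs T).toLinearMap.IsSymmetric :=
  (isSelfAdjoint_iff_isSymmetric).1 (IsSelfAdjoint.of_nonneg (CFC.abs_nonneg T))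

/-- `T` is bounded below by `t` on the span of the eigenvectors of `|T|` for eigenvalues `≥ t`. -/
theorem mul_norm_le_of_mem_absEigenspaceGE {T : H →L[ℂ] H} {t : ℝ} (ht : 0 ≤ t) {x : H}
    (hx : x ∈ absEigenspaceGE T t) : t * ‖x‖ ≤ ‖T x‖ := by
  classical
  rw [absEigenspaceGE, iSup_subtype', Submodule.mem_iSup_iff_exists_finsupp] at hx
  obtain ⟨f, hf, rfl⟩ := hx
  have horth : OrthogonalFamily ℂ
      (fun μ : Set.Ici t => Module.End.eigenspace (CFC.abs T).toLinearMap ((μ : ℝ) : ℂ))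
      fun μ => (Module.End.eigenspace (CFC.abs T).toLinearMap ((μ : ℝ) : ℂ)).subtypeₗᵢ :=
    (isSymmetric_cfcAbs T).orthogonalFamily_eigenspaces.comp
      (γ := Set.Ici t) (f := fun μ => ((μ : ℝ) : ℂ))
      (fun a b h => Subtype.ext (Complex.ofReal_injective h))
  have h1 : ‖∑ i ∈ f.support, f i‖ ^ 2 = ∑ i ∈ f.support, ‖f i‖ ^ 2 :=
    horth.norm_sum (fun i => ⟨f i, hf i⟩) f.support
  have h2 : ‖∑ i ∈ f.support, ((i : ℝ) : ℂ) • f i‖ ^ 2 =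
      ∑ i ∈ f.support, ‖((i : ℝ) : ℂ) • f i‖ ^ 2 :=
    horth.norm_sum (fun i => ((i : ℝ) : ℂ) • ⟨f i, hf i⟩) f.support
  have h3 : CFC.abs T (f.sum fun _ y => y) = ∑ i ∈ f.support, ((i : ℝ) : ℂ) • f i := by
    rw [Finsupp.sum, map_sum]
    exact Finset.sum_congr rfl fun i _ => Module.End.mem_eigenspace_iff.1 (hf i)
  rw [← norm_cfcAbs_apply, h3]
  refine le_of_sq_le_sq ?_ (norm_nonneg _)
  rw [mul_pow, h2, Finsupp.sum, h1, Finset.mul_sum]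
  refine Finset.sum_le_sum fun i _ => ?_
  rw [norm_smul, mul_pow, Complex.norm_real, Real.norm_eq_abs, sq_abs]
  have : t ≤ (i : ℝ) := i.2
  gcongr

/-- The numbers `t` whose supremum is the singular value are bounded by the operator norm. -/
theorem le_norm_of_le_rank_absEigenspaceGE {T : H →L[ℂ] H} {j : ℕ} (hj : 1 ≤ j) {t : ℝ}
    (ht : 0 < t) (h : (j : Cardinal) ≤ Module.rank ℂ (absEigenspaceGE T t)) : t ≤ ‖T‖ := by
  have hne : absEigenspaceGE T t ≠ ⊥ := by
    intro h0
    rw [h0, rank_bot] at h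
    have : j ≤ 0 := by exact_mod_cast h
    omega
  obtain ⟨x, hx, hx0⟩ := Submodule.exists_mem_ne_zero_of_ne_bot hne
  have h1 := (mul_norm_le_of_mem_absEigenspaceGE ht.le hx).trans (T.le_opNorm x)
  exact le_of_mul_le_mul_right h1 (norm_pos_iff.2 hx0)

/-- For a compact positive operator `B`, the Rayleigh quotient is `< t` on the orthogonal complement
of the eigenvectors for eigenvalues `≥ t`. -/
theorem re_inner_lt_of_mem_orthogonal_absEigenspaceGE {B : H →L[ℂ] H} (hB : IsCompactOperator B)
    (hpos : 0 ≤ B) {t : ℝ} (ht : 0 < t) {x : H} (hx : x ∈ (absEigenspaceGE B t)ᗮ) (hx0 : x ≠ 0) :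
    RCLike.re (inner ℂ x (B x)) < t * ‖x‖ ^ 2 := by
  have : Nontrivial H := ⟨x, 0, hx0⟩
  set W := absEigenspaceGE B t with hW
  have hWdef : W = ⨆ μ ∈ Set.Ici t, Module.End.eigenspace B.toLinearMap (μ : ℂ) := by
    rw [hW, absEigenspaceGE, CFC.abs_of_nonneg B hpos]
  have hBp : B.IsPositive := (nonneg_iff_isPositive B).1 hpos
  have hinv : ∀ v ∈ Wᗮ, B v ∈ Wᗮ := by
    intro v hv
    have hle : W ≤ W.comap B.toLinearMap := by
      conv_lhs => rw [hWdef]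
      refine iSup₂_le fun μ hμ w hw => ?_
      have hwW : w ∈ W := by
        rw [hWdef]
        exact Submodule.mem_iSup_of_mem μ (Submodule.mem_iSup_of_mem hμ hw)
      rw [Submodule.mem_comap, Module.End.mem_eigenspace_iff.1 hw]
      exact W.smul_mem _ hwW
    rw [Submodule.mem_orthogonal] at hv ⊢
    intro w hw
    rw [← hBp.inner_left_eq_inner_right]
    exact hv _ (hle hw)
  set P := (Wᗮ).starProjection with hP
  set C := P ∘L B ∘L P with hC
  have hCpos : 0 ≤ C := (nonneg_iff_isPositive C).2 (hBp.conj_starProjection Wᗮ)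
  have hCcomp : IsCompactOperator C := (hB.comp_clm P).clm_comp P
  have hCx : C x = B x := by
    simp only [hC, coe_comp, Function.comp_apply]
    rw [hP, Submodule.starProjection_eq_self_iff.2 hx,
      Submodule.starProjection_eq_self_iff.2 (hinv x hx)]
  -- The norm of a compact positive operator, if nonzero, is an eigenvalue. An eigenvector of the
  -- compression `C` for `‖C‖ ≥ t` would be one of `B` too, hence lie in both `W` and `Wᗮ`.
  have hlt : ‖C‖ < t := by
    by_contra! hge
    have hr : (‖C‖ : ℂ) ≠ 0 := by exact_mod_cast (ht.trans_le hge).ne'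
    have hspec : (‖C‖ : ℂ) ∈ spectrum ℂ C :=
      spectrum.algebraMap_mem ℂ (CStarAlgebra.norm_mem_spectrum_of_nonneg hCpos)
    obtain ⟨v, hv⟩ := ((hCcomp.hasEigenvalue_iff_mem_spectrum hr).2 hspec).exists_hasEigenvector
    have hCv : C v = (‖C‖ : ℂ) • v := hv.apply_eq_smul
    have hvW : v ∈ Wᗮ := by
      have h1 : (‖C‖ : ℂ) • v ∈ Wᗮ := by
        rw [← hCv]
        exact Submodule.starProjection_apply_mem _ _
      exact ((Wᗮ).smul_mem_iff hr).1 h1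
    have hBv : B v = (‖C‖ : ℂ) • v := by
      rw [← hCv]
      simp only [hC, coe_comp, Function.comp_apply]
      rw [hP, Submodule.starProjection_eq_self_iff.2 hvW,
        Submodule.starProjection_eq_self_iff.2 (hinv v hvW)]
    have hvW' : v ∈ W := by
      rw [hWdef]
      exact Submodule.mem_iSup_of_mem ‖C‖
        (Submodule.mem_iSup_of_mem hge (Module.End.mem_eigenspace_iff.2 hBv))
    exact hv.2 (inner_self_eq_zero.1 (hvW v hvW'))
  have hxpos : 0 < ‖x‖ := norm_pos_iff.2 hx0
  calc RCLike.re (inner ℂ x (B x)) ≤ ‖x‖ * ‖C x‖ := by rw [hCx]; exact re_inner_le_norm _ _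
    _ ≤ ‖x‖ * (‖C‖ * ‖x‖) := by gcongr; exact C.le_opNorm x
    _ = ‖C‖ * ‖x‖ ^ 2 := by ring
    _ < t * ‖x‖ ^ 2 := by gcongr

/-- If `S* S ≤ B` with `B` compact, then `|B| = B` has at least as many eigenvalues `≥ t ^ 2` as
`|S|` has eigenvalues `≥ t`, up to any finite count `j`. -/
theorem le_rank_absEigenspaceGE_sq {S B : H →L[ℂ] H} (hB : IsCompactOperator B) (hpos : 0 ≤ B)
    (hSB : ∀ x, ‖S x‖ ^ 2 ≤ RCLike.re (inner ℂ x (B x))) {j : ℕ} {t : ℝ} (ht : 0 < t)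
    (h : (j : Cardinal) ≤ Module.rank ℂ (absEigenspaceGE S t)) :
    (j : Cardinal) ≤ Module.rank ℂ (absEigenspaceGE B (t ^ 2)) := by
  by_contra! hlt
  set W := absEigenspaceGE B (t ^ 2)
  -- Finite dimension provides the orthogonal projection onto `W`.
  have : FiniteDimensional ℂ W :=
    Module.rank_lt_aleph0_iff.1 (hlt.trans (Cardinal.natCast_lt_aleph0))
  let f : absEigenspaceGE S t →ₗ[ℂ] W :=
    W.orthogonalProjectionOnto.toLinearMap ∘ₗ (absEigenspaceGE S t).subtype
  have hf : Function.Injective f := by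
    rw [injective_iff_map_eq_zero]
    rintro ⟨x, hx⟩ hfx
    by_contra hx0
    have hx0' : x ≠ 0 := fun h0 => hx0 (Subtype.ext h0)
    have hxW : x ∈ Wᗮ := Submodule.orthogonalProjectionOnto_eq_zero_iff.1 hfx
    have h1 := re_inner_lt_of_mem_orthogonal_absEigenspaceGE hB hpos (by positivity) hxW hx0'
    have h2 := mul_norm_le_of_mem_absEigenspaceGE ht.le hx
    have h3 : (t * ‖x‖) ^ 2 ≤ ‖S x‖ ^ 2 := by gcongr
    linarith [hSB x, mul_pow t ‖x‖ 2]
  exact (h.trans (LinearMap.rank_le_of_injective f hf)).not_gt hlt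

/-- Monotonicity of singular values: `S* S ≤ B` with `B` compact implies `s_j(S)² ≤ s_j(B)`. -/
theorem singularValue_sq_le {S B : H →L[ℂ] H} (hB : IsCompactOperator B) (hpos : 0 ≤ B)
    (hSB : ∀ x, ‖S x‖ ^ 2 ≤ RCLike.re (inner ℂ x (B x))) {j : ℕ} (hj : 1 ≤ j) :
    singularValue S j ^ 2 ≤ singularValue B j := by
  have hnn : ∀ A : H →L[ℂ] H, 0 ≤ singularValue A j := fun A => Real.sSup_nonneg fun t ht => ht.1.le
  -- Taking roots allows each admissible `t` to be bounded separately; an empty set is harmless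
  -- since `sSup ∅ = 0`.
  refine (Real.le_sqrt (hnn S) (hnn B)).1 (Real.sSup_le (fun t ht => ?_) (Real.sqrt_nonneg _))
  refine Real.le_sqrt_of_sq_le (le_csSup ⟨‖B‖, fun u hu => ?_⟩ ⟨by have := ht.1; positivity, ?_⟩)
  · exact le_norm_of_le_rank_absEigenspaceGE hj hu.1 hu.2
  · exact le_rank_absEigenspaceGE_sq hB hpos hSB ht.1 ht.2

end SingularValues

theorem mainTheorem6 {H : Type*} [NormedAddCommGroup H] [InnerProductSpace ℂ H] [CompleteSpace H]
    (n : ℕ) (T : Fin n → H →L[ℂ] H) (hT : ∀ k, IsCompactOperator (T k))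
    (j : ℕ) (hj : 1 ≤ j) :
    (singularValue (∑ k, T k) j) ^ 2 ≤
      singularValue
        ((∑ k, ContinuousLinearMap.adjoint (T k) ∘L T k) +
          (1 / 2 : ℂ) •
            (((n : ℂ) - 2) • (∑ k, ContinuousLinearMap.adjoint (T k) ∘L T k) +
              (∑ k, ContinuousLinearMap.adjoint (T k)) ∘L (∑ k, T k))) j := by
  -- Since `1 + (n - 2) / 2 = n / 2`, this form has nonnegative coefficients even for `n < 2`.
  have hB : (∑ k, ContinuousLinearMap.adjoint (T k) ∘L T k) +
          (1 / 2 : ℂ) •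
            (((n : ℂ) - 2) • (∑ k, ContinuousLinearMap.adjoint (T k) ∘L T k) +
              (∑ k, ContinuousLinearMap.adjoint (T k)) ∘L (∑ k, T k)) =
      (n / 2 : ℂ) • (∑ k, ContinuousLinearMap.adjoint (T k) ∘L T k) +
        (1 / 2 : ℂ) • (ContinuousLinearMap.adjoint (∑ k, T k) ∘L (∑ k, T k)) := by
    rw [map_sum]
    module
  rw [hB]
  refine singularValue_sq_le ?_ ?_ (fun x => ?_) hj
  · exact ((isCompactOperator_sum _ fun k =>
      (hT k).clm_comp (ContinuousLinearMap.adjoint (T k))).smul (n / 2 : ℂ)).add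
      (((isCompactOperator_sum _ hT).clm_comp
        (ContinuousLinearMap.adjoint (∑ k, T k))).smul (1 / 2 : ℂ))
  · rw [ContinuousLinearMap.nonneg_iff_isPositive]
    refine .add (.smul_of_nonneg (ContinuousLinearMap.isPositive_sum _ fun k _ =>
        ContinuousLinearMap.isPositive_adjoint_comp_self (T k)) ?_)
      (.smul_of_nonneg (ContinuousLinearMap.isPositive_adjoint_comp_self _) ?_)
    · simpa using Complex.zero_le_real.2 (by positivity : (0 : ℝ) ≤ n / 2)
    · simpa using Complex.zero_le_real.2 (by positivity : (0 : ℝ) ≤ 1 / 2)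
  · have hre : RCLike.re (inner ℂ x (((n / 2 : ℂ) •
          (∑ k, ContinuousLinearMap.adjoint (T k) ∘L T k) +
        (1 / 2 : ℂ) • (ContinuousLinearMap.adjoint (∑ k, T k) ∘L (∑ k, T k))) x)) =
        n / 2 * ∑ k, ‖T k x‖ ^ 2 + 1 / 2 * ‖(∑ k, T k) x‖ ^ 2 := by
      have h1 : ∀ A : H →L[ℂ] H, inner ℂ x ((ContinuousLinearMap.adjoint A ∘L A) x) =
          ((‖A x‖ ^ 2 : ℝ) : ℂ) := fun A => by
        rw [ContinuousLinearMap.comp_apply, ContinuousLinearMap.adjoint_inner_right,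
          inner_self_eq_norm_sq_to_K]
        norm_cast
      rw [_root_.add_apply, _root_.smul_apply,
        _root_.smul_apply, inner_add_right, inner_smul_right, inner_smul_right, h1,
        _root_.sum_apply, inner_sum, Finset.sum_congr rfl fun k _ => h1 (T k)]
      have h2 : (n / 2 : ℂ) * ∑ k, ((‖T k x‖ ^ 2 : ℝ) : ℂ) +
          1 / 2 * ((‖(∑ k, T k) x‖ ^ 2 : ℝ) : ℂ) =
          ((n / 2 * ∑ k, ‖T k x‖ ^ 2 + 1 / 2 * ‖(∑ k, T k) x‖ ^ 2 : ℝ) : ℂ) := by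
        push_cast
        rfl
      rw [h2]
      exact Complex.ofReal_re _
    rw [hre]
    -- Half of `‖S x‖ ^ 2` is already present in `⟨x, B x⟩`; Cauchy–Schwarz bounds the other half.
    have := norm_sq_sum_apply_le T x
    rw [Fintype.card_fin] at this
    linarith
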